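/- Let $p\geqslant 1$ and $n_1,\ldots,n_p\geqslant 1$ be integers, let $n=n_1+\cdots+n_p$, and let $A$ be an $n\times n$ matrix over a commutative ring, written in blocks $A=(A_{[ab]})_{1\leqslant a,b\leqslant p}$ with $A_{[ab]}$ of size $n_a\times n_b$. Assume that for each $a\in\{1,\ldots,p\}$ the diagonal block $A_{[aa]}$ is of the form $z_a I_{n_a}$ for some scalar $z_a$. A *cyclic walk* $c=(\!(a_1,\ldots,a_k)\!)$ on $\{1,\ldots,p\}$ is a list of length $k\geqslant 2$ of elements of $\{1,\ldots,p\}$, considered up to cyclic permutation, such that $a_1\neq a_2,\ldots,a_{k-1}\neq a_k,\ a_k\neq a_1$. Its *valuation* $\mathrm{val}(c)$ is the order of the stabiliser of $(a_1,\ldots,a_k)$ under the action of $\mathbb{Z}/k\mathbb{Z}$ by cyclic permutations, $v_a(c)=|\{i : a_i=a\}|$ is its number of visits at $a$, and $$W(A,c)=\mathrm{Tr}\big(A_{[a_1a_2]}A_{[a_2a_3]}\cdots A_{[a_ka_1]}\big),$$ which does not depend on the choice of the starting point. For a finite multiset $\mathsf C$ of cyclic walks, let $v_a(\mathsf C)=\sum_{c\in\mathsf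 C}v_a(c)$, where multiplicities are taken into account, and let $\mathsf C!$ be the product of the factorials of the multiplicities of the distinct elements of $\mathsf C$. Let $\mathcal M_{\leqslant\underline n}$ be the (finite) set of multisets $\mathsf C$ of cyclic walks such that $v_a(\mathsf C)\leqslant n_a$ for all $a$; it contains the empty multiset. Finally, let $\underline z^{\underline n-\underline v(\mathsf C)}=\prod_{a=1}^p z_a^{n_a-v_a(\mathsf C)}$. Products over $c\in\mathsf C$ take multiplicities into account. 1. If the entries of $A$ belong to a field of characteristic $0$, then $$\det A=\sum_{\mathsf C\in\mathcal M_{\leqslant\underline n}}\frac{\underline z^{\underline n-\underline v(\mathsf C)}}{\mathsf C!}\prod_{c\in\mathsf C}\frac{-W(-A,c)}{\mathrm{val}(c)}.$$ 2. For every $\mathsf C\in\mathcal M_{\leqslant\underline n}$, the integer $\mathsf C!\prod_{c\in\mathsf C}\mathrm{val}(c)$ divides $n_1!\cdots n_p!$, and if the entries of $A$ belong to an arbitrary commutative ring, then $$n_1!\cdots n_p!\,\det A=\sum_{\mathsf C\in\mathcal M_{\leqslant\underline n}}\frac{n_1!\cdots n_p!}{\mathsf C!\prod_{c\in\mathsf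 C}\mathrm{val}(c)}\;\underline z^{\underline n-\underline v(\mathsf C)}\prod_{c\in\mathsf C}-W(-A,c).$$ -/

import Mathlib

open scoped Nat

namespace BlockWalk

/-! ### Block matrices

A block matrix with `p` diagonal blocks of sizes `n 0, …, n (p - 1)` is a square matrix whose rows
and columns are indexed by the pairs `⟨a, i⟩` where `a : Fin p` is the index of a block and
`i : Fin (n a)` is a position inside of that block. -/

/-- The index set of the rows and columns of a block matrix with block sizes `n`. -/
abbrev Idx {p : ℕ} (n : Fin p → ℕ) : Type := (a : Fin p) × Fin (n a)

section Blocks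

variable {R : Type*} {p : ℕ} {n : Fin p → ℕ}

/-- The block in position `(a, b)` of a block matrix, of size `n a × n b`. -/
def block (A : Matrix (Idx n) (Idx n) R) (a b : Fin p) : Matrix (Fin (n a)) (Fin (n b)) R :=
  Matrix.of fun i j => A ⟨a, i⟩ ⟨b, j⟩

/-- For `l = [c₁, …, c_k]`, the product `A_[a c₁] A_[c₁ c₂] ⋯ A_[c_k b]` of the blocks of `A` along
the path from `a` to `b` through `c₁, …, c_k`. -/
def pathProd [CommRing R] (A : Matrix (Idx n) (Idx n) R) :
    (a : Fin p) → List (Fin p) → (b : Fin p) → Matrix (Fin (n a)) (Fin (n b)) R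
  | a, [], b => block A a b
  | a, c :: l, b => block A a c * pathProd A c l b

/-- The trace `Tr (A_[a₁ a₂] ⋯ A_[a_k a₁])` attached to the list `[a₁, …, a_k]`. The value at the
empty list is never used. -/
def listTrace [CommRing R] (A : Matrix (Idx n) (Idx n) R) : List (Fin p) → R
  | [] => 0
  | a :: l => (pathProd A a l a).trace

theorem pathProd_append_singleton [CommRing R] (A : Matrix (Idx n) (Idx n) R)
    (l : List (Fin p)) (a b c : Fin p) :
    pathProd A c (l ++ [a]) b = pathProd A c l a * block A a b := by
  induction l generalizing c with
  | nil => rfl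
  | cons d l ih => simp only [List.cons_append, pathProd, ih, Matrix.mul_assoc]

theorem listTrace_cons [CommRing R] (A : Matrix (Idx n) (Idx n) R) (a : Fin p)
    (l : List (Fin p)) : listTrace A (l ++ [a]) = listTrace A (a :: l) := by
  cases l with
  | nil => rfl
  | cons c l =>
    simp only [List.cons_append, listTrace, pathProd, pathProd_append_singleton]
    exact Matrix.trace_mul_comm _ _

theorem listTrace_rotate [CommRing R] (A : Matrix (Idx n) (Idx n) R) (l : List (Fin p)) (m : ℕ) :
    listTrace A (l.rotate m) = listTrace A l := by
  induction m generalizing l with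
  | zero => simp
  | succ m ih =>
    cases l with
    | nil => simp
    | cons a l => rw [List.rotate_cons_succ, ih, listTrace_cons]

end Blocks

/-! ### Cyclic walks -/

/-- The cardinality of the stabiliser of the tuple `l = (a₁, …, a_k)` under the action of
`ℤ / kℤ = {0, …, k - 1}` on `k`-tuples by cyclic permutations. -/
def listVal {α : Type*} [DecidableEq α] (l : List α) : ℕ :=
  ((Finset.range l.length).filter fun i => l.rotate i = l).card

theorem listVal_rotate {α : Type*} [DecidableEq α] (l : List α) (m : ℕ) :
    listVal (l.rotate m) = listVal l := by
  unfold listVal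
  rw [List.length_rotate]
  congr 1
  ext i
  simp only [Finset.mem_filter, and_congr_right_iff]
  intro _
  rw [List.rotate_rotate, Nat.add_comm, ← List.rotate_rotate]
  exact (List.rotate_injective m).eq_iff

/-- A cyclic walk on `Fin p`: a cyclically ordered list (a list up to rotation) of length at least
two, in which any two cyclically successive elements are distinct. -/
abbrev CyclicWalk (p : ℕ) : Type :=
  {c : Cycle (Fin p) // 2 ≤ c.length ∧ c.Chain (· ≠ ·)}

namespace CyclicWalk

variable {p : ℕ}

/-- The valuation of a cyclic walk of length `k`: the order of the stabiliser in `ℤ / kℤ` of any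
`k`-tuple which represents it. -/
def val (c : CyclicWalk p) : ℕ :=
  Quotient.liftOn' c.1 listVal (by
    rintro l _ ⟨m, rfl⟩
    exact (listVal_rotate l m).symm)

/-- The number of visits of a cyclic walk at the vertex `a`. -/
def visits (c : CyclicWalk p) (a : Fin p) : ℕ := c.1.toMultiset.count a

end CyclicWalk

/-- `W(A, c) = Tr (A_[a₁ a₂] ⋯ A_[a_k a₁])` for a cyclic walk `c = ((a₁, …, a_k))`. -/
def W {R : Type*} [CommRing R] {p : ℕ} {n : Fin p → ℕ} (A : Matrix (Idx n) (Idx n) R)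
    (c : CyclicWalk p) : R :=
  Quotient.liftOn' c.1 (listTrace A) (by
    rintro l _ ⟨m, rfl⟩
    exact (listTrace_rotate A l m).symm)

/-! ### Multisets of cyclic walks -/

section Multisets

variable {p : ℕ}

/-- The total number of visits at `a` of the elements of `C`, with multiplicities. -/
def totalVisits (C : Multiset (CyclicWalk p)) (a : Fin p) : ℕ :=
  (C.map fun c => c.visits a).sum

/-- `C!`, the product of the factorials of the multiplicities of the elements of `C`. -/
def multFactorial (C : Multiset (CyclicWalk p)) : ℕ :=
  ∏ c ∈ C.toFinset, (C.count c)!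

/-- The product of the valuations of the elements of `C`, with multiplicities. -/
def valProd (C : Multiset (CyclicWalk p)) : ℕ :=
  (C.map fun c => c.val).prod

/-- The set of multisets of cyclic walks which visit each vertex `a` at most `n a` times. -/
def boundedSet (n : Fin p → ℕ) : Set (Multiset (CyclicWalk p)) :=
  {C | ∀ a, totalVisits C a ≤ n a}

theorem sum_visits (c : CyclicWalk p) : ∑ a, c.visits a = c.1.length := by
  rw [← Cycle.card_toMultiset]
  exact Multiset.sum_count_eq_card fun a _ => Finset.mem_univ a

theorem sum_totalVisits (C : Multiset (CyclicWalk p)) :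
    ∑ a, totalVisits C a = (C.map fun c => c.1.length).sum := by
  unfold totalVisits
  induction C using Multiset.induction_on with
  | empty => simp
  | cons c C ih => simp [Finset.sum_add_distrib, ih, sum_visits]

theorem finite_boundedSet (n : Fin p → ℕ) : (boundedSet n).Finite := by
  set N := ∑ a, n a
  have h1 : {c : CyclicWalk p | c.1.length ≤ N}.Finite := by
    have : {c : Cycle (Fin p) | c.length ≤ N}.Finite := by
      refine ((List.finite_length_le (Fin p) N).image
        fun l : List (Fin p) => (l : Cycle (Fin p))).subset ?_
      intro c hc
      induction c using Quotient.inductionOn' with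
      | h l => exact ⟨l, hc, rfl⟩
    exact this.preimage Subtype.val_injective.injOn
  have : Finite {c : CyclicWalk p // c.1.length ≤ N} := h1
  refine ((List.finite_length_le {c : CyclicWalk p // c.1.length ≤ N} N).image
    fun l => ((l.map Subtype.val : List (CyclicWalk p)) : Multiset (CyclicWalk p))).subset ?_
  intro C hC
  have hsum : (C.map fun c => c.1.length).sum ≤ N := by
    rw [← sum_totalVisits]
    exact Finset.sum_le_sum fun a _ => hC a
  have hlen : ∀ c ∈ C, c.1.length ≤ N := fun c hc =>
    (Multiset.single_le_sum (fun _ _ => Nat.zero_le _) _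
      (Multiset.mem_map_of_mem (fun c : CyclicWalk p => c.1.length) hc)).trans hsum
  have hcard : Multiset.card C ≤ N := by
    refine le_trans ?_ hsum
    have := Multiset.card_nsmul_le_sum (s := C.map fun c => c.1.length) (a := 1) (by
      intro x hx
      obtain ⟨c, _, rfl⟩ := Multiset.mem_map.1 hx
      exact le_trans one_le_two c.2.1)
    simpa using this
  induction C using Quotient.inductionOn with
  | h l =>
    refine ⟨l.attach.map fun c => ⟨c.1, hlen c.1 c.2⟩, ?_, ?_⟩
    · simpa using hcard
    · have h := List.attach_map_subtype_val l
      simp only [List.map_map, Function.comp_def]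
      exact congrArg _ h

/-- The finite set of multisets of cyclic walks which visit each vertex `a` at most `n a` times,
as a `Finset`. -/
noncomputable def bounded (n : Fin p → ℕ) : Finset (Multiset (CyclicWalk p)) :=
  (finite_boundedSet n).toFinset

theorem mem_bounded (n : Fin p → ℕ) (C : Multiset (CyclicWalk p)) :
    C ∈ bounded n ↔ ∀ a, totalVisits C a ≤ n a := by
  simp [bounded, boundedSet]

end Multisets

end BlockWalk

open BlockWalk

/-! Let `N` be the off-diagonal part of `A`. When every `z a` is invertible, `A = Z (1 - M)` with
`Z` the diagonal of scalars and `M = -Z⁻¹ N`. Formally, `log det (1 - M) = -∑ Tr (M ^ k) / k`.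
Expanding the trace over closed block paths, only cyclic walks survive, and a walk `c` of length `k`
is represented by `k / val c` lists, so the logarithm is `∑ c, -W(M, c) / val c`. Its exponential is
a sum over all multisets of walks, with the weight `1 / C!`.

The bound on visits comes from a degree argument: with `Z⁻¹` replaced by variables `Y`, the
determinant has degree at most `n a` in `Y a`, while `C` contributes a multiple of `Y ^ v(C)`, so
the contributions beyond the bound cancel (`det_one_sub_negScaled`). No power series is needed: the
coefficients of `det (1 - X M)` satisfy Newton's identities (`newton_charpolyRev`), the sums over
multisets of given total length satisfy the same recursion (`sum_expWeight_succ`), and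
characteristic zero allows division by the degree.

After multiplication by `∏ a, (n a)!` both sides are integral polynomials in the entries and the `z
a`. The identity is proved for the generic matrix, in a fraction field where the `z a` are nonzero,
and then specialised to any commutative ring. The field formula follows by dividing the factorials
out. -/

namespace BlockWalk

/-! ### Newton's identities for `det (1 - X M)`. -/

open Polynomial in
/-- Jacobi's formula for the derivative of a determinant. -/
theorem derivative_det {ι R : Type*} [Fintype ι] [DecidableEq ι] [CommRing R]
    (M : Matrix ι ι R[X]) :
    derivative M.det = (M.adjugate * M.map derivative).trace := by
  have h : ∀ i, (M.adjugate * M.map derivative) i i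
      = (M.updateCol i fun j => derivative (M j i)).det := by
    intro i
    rw [← Matrix.cramer_apply, Matrix.cramer_eq_adjugate_mulVec]
    rfl
  simp only [Matrix.trace, Matrix.diag, h]
  simp only [Matrix.det_apply, derivative_sum, derivative_smul, derivative_prod_finset]
  rw [Finset.sum_comm]
  refine Finset.sum_congr rfl fun σ _ => ?_
  rw [← Finset.smul_sum]
  congr 1
  have h2 : ∀ i, ∏ j, (M.updateCol i fun j => derivative (M j i)) (σ j) j
      = (∏ j ∈ Finset.univ.erase i, M (σ j) j) * derivative (M (σ i) i) := by
    intro i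
    rw [← Finset.prod_erase_mul _ _ (Finset.mem_univ i)]
    congr 1
    · refine Finset.prod_congr rfl fun j hj => ?_
      rw [Matrix.updateCol_ne (Finset.ne_of_mem_erase hj)]
    · rw [Matrix.updateCol_self]
  simp only [h2]

open Polynomial in
/-- The coefficients of the adjugate of `1 - X M`. -/
theorem coeff_adjugate_one_sub_X_smul {ι R : Type*} [Fintype ι] [DecidableEq ι] [CommRing R]
    (M : Matrix ι ι R) (m : ℕ) :
    ((1 - (X : R[X]) • M.map C).adjugate.map fun q => q.coeff m)
      = ∑ i ∈ Finset.range (m + 1), M.charpolyRev.coeff (m - i) • M ^ i := by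
  set B := (1 - (X : R[X]) • M.map C).adjugate with hB
  -- This is `adj(1 - X M) (1 - X M) = det(1 - X M)` rearranged; its coefficients give a recursion
  -- for those of `B`.
  have h : B = M.charpolyRev • (1 : Matrix ι ι R[X]) + (X : R[X]) • (B * M.map C) := by
    have := Matrix.adjugate_mul (1 - (X : R[X]) • M.map C)
    rw [← hB, mul_sub, mul_one, Matrix.mul_smul] at this
    rw [← sub_eq_iff_eq_add]
    exact this
  have h1 : ∀ i j k, ((B * M.map C) i j).coeff k = ((B.map fun q => q.coeff k) * M) i j := by
    intro i j k
    simp [Matrix.mul_apply, finsetSum_coeff, coeff_mul_C]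
  induction m with
  | zero =>
    ext i j
    have := congrArg (fun q => (q i j).coeff 0) h
    simp only [Matrix.add_apply, Matrix.smul_apply, coeff_add, smul_eq_mul, coeff_X_mul_zero,
      add_zero] at this
    simp only [Matrix.map_apply, this]
    by_cases hij : i = j <;> simp [hij, Matrix.one_apply]
  | succ m ih =>
    rw [Finset.sum_range_succ']
    have : ∑ i ∈ Finset.range (m + 1), M.charpolyRev.coeff (m + 1 - (i + 1)) • M ^ (i + 1)
        = (B.map fun q => q.coeff m) * M := by
      rw [ih, Finset.sum_mul]
      refine Finset.sum_congr rfl fun i _ => ?_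
      rw [Matrix.smul_mul, pow_succ, Nat.add_sub_add_right]
    rw [this]
    ext i j
    have := congrArg (fun q => (q i j).coeff (m + 1)) h
    simp only [Matrix.add_apply, Matrix.smul_apply, coeff_add, smul_eq_mul, coeff_X_mul, h1]
      at this
    simp only [Matrix.map_apply, this, Matrix.add_apply]
    rw [add_comm]
    by_cases hij : i = j <;> simp [hij, Matrix.one_apply]

open Polynomial in
/-- Newton's identities for the coefficients of `det (1 - X M)`. -/
theorem newton_charpolyRev {ι R : Type*} [Fintype ι] [DecidableEq ι] [CommRing R]
    (M : Matrix ι ι R) (m : ℕ) :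
    (m + 1 : R) * M.charpolyRev.coeff (m + 1)
      = ∑ i ∈ Finset.range (m + 1), M.charpolyRev.coeff (m - i) * -(M ^ (i + 1)).trace := by
  have h : (1 - (X : R[X]) • M.map C).map derivative = -M.map C := by
    ext1 i j
    by_cases hij : i = j <;> simp [hij]
  have h2 := congrArg (fun q => q.coeff m) (derivative_det (1 - (X : R[X]) • M.map C))
  simp only [h] at h2
  rw [coeff_derivative] at h2
  change M.charpolyRev.coeff (m + 1) * _ = _ at h2
  rw [mul_comm, h2]
  have h3 := coeff_adjugate_one_sub_X_smul M m
  set B := (1 - (X : R[X]) • M.map C).adjugate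
  have h4 : (B * -M.map C).trace.coeff m = - ((B.map fun q => q.coeff m) * M).trace := by
    simp [Matrix.trace, Matrix.mul_apply, coeff_mul_C]
  rw [h4, h3, Finset.sum_mul, Matrix.trace_sum, ← Finset.sum_neg_distrib]
  refine Finset.sum_congr rfl fun i _ => ?_
  rw [Matrix.smul_mul, Matrix.trace_smul, ← pow_succ, smul_eq_mul, mul_neg]

theorem W_mk {R : Type*} [CommRing R] {p : ℕ} {n : Fin p → ℕ} (A : Matrix (Idx n) (Idx n) R)
    (l : List (Fin p)) (h) : W A ⟨(l : Cycle (Fin p)), h⟩ = listTrace A l := rfl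

/-! ### Rotations of a list and the valuation. -/

section Rotations

variable {α : Type*} [DecidableEq α]

theorem listVal_pos {l : List α} (h : l ≠ []) : 0 < listVal l := by
  refine Finset.card_pos.2 ⟨0, ?_⟩
  simpa using List.length_pos_iff.2 h

/-- Two rotations with the same result differ by an element of the stabiliser; adding `l.length - j`
subtracts `j` modulo the length without leaving `ℕ`. -/
theorem rotate_sub_mod {α : Type*} {l l' : List α} {i j : ℕ} (hj : j < l.length) (h : l.rotate j = l')
    (hi : l.rotate i = l') :
    l'.rotate ((i + (l.length - j)) % l.length) = l' := by
  subst h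
  rw [← List.length_rotate l j, List.rotate_mod, List.rotate_rotate, List.length_rotate,
    show j + (i + (l.length - j)) = i + l.length by omega, ← List.rotate_rotate, hi]
  exact (by simpa using List.rotate_length (l.rotate j))

/-- The indices that rotate `l` to `l'` form a coset of the stabiliser. -/
theorem card_filter_rotate_eq {l l' : List α} (h : l ~r l') (hl : l ≠ []) :
    ((Finset.range l.length).filter fun i => l.rotate i = l').card = listVal l := by
  obtain ⟨j, rfl⟩ := h
  have hpos := List.length_pos_iff.2 hl
  rw [← List.rotate_mod]
  have hj := Nat.mod_lt j hpos
  generalize j % l.length = j at hj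
  unfold listVal
  symm
  refine Finset.card_bij' (fun i _ => (i + j) % l.length)
    (fun i _ => (i + (l.length - j)) % l.length) ?_ ?_ ?_ ?_
  · intro i hi
    simp only [Finset.mem_filter, Finset.mem_range] at hi ⊢
    refine ⟨Nat.mod_lt _ hpos, ?_⟩
    rw [List.rotate_mod, ← List.rotate_rotate, hi.2]
  · intro i hi
    simp only [Finset.mem_filter, Finset.mem_range] at hi ⊢
    refine ⟨Nat.mod_lt _ hpos, ?_⟩
    have := rotate_sub_mod hj rfl hi.2
    rw [List.rotate_rotate, Nat.add_comm, ← List.rotate_rotate] at this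
    exact List.rotate_injective j this
  · intro i hi
    simp only [Finset.mem_filter, Finset.mem_range] at hi
    rw [Nat.mod_add_mod, show i + j + (l.length - j) = i + l.length by omega,
      Nat.add_mod_right, Nat.mod_eq_of_lt hi.1]
  · intro i hi
    simp only [Finset.mem_filter, Finset.mem_range] at hi
    rw [Nat.mod_add_mod, show i + (l.length - j) + j = i + l.length by omega,
      Nat.add_mod_right, Nat.mod_eq_of_lt hi.1]

/-- The number of distinct rotations of a list times its valuation is its length. -/
theorem card_rotations_mul_listVal {l : List α} (hl : l ≠ []) :
    ((Finset.range l.length).image l.rotate).card * listVal l = l.length := by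
  have := Finset.card_eq_sum_card_image l.rotate (Finset.range l.length)
  rw [Finset.card_range] at this
  conv_rhs => rw [this]
  rw [Finset.sum_const_nat]
  intro l' hl'
  obtain ⟨j, -, rfl⟩ := Finset.mem_image.1 hl'
  exact card_filter_rotate_eq ⟨j, rfl⟩ hl

theorem mem_image_rotate_iff {l l' : List α} (hl : l ≠ []) :
    l' ∈ (Finset.range l.length).image l.rotate ↔ (l' : Cycle α) = l := by
  rw [Cycle.coe_eq_coe, Finset.mem_image]
  constructor
  · rintro ⟨j, -, rfl⟩
    exact List.IsRotated.forall l j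
  · intro h
    obtain ⟨j, rfl⟩ := h.symm
    refine ⟨j % l.length, Finset.mem_range.2 (Nat.mod_lt _ (List.length_pos_iff.2 hl)), ?_⟩
    rw [List.rotate_mod]

theorem count_eq_card_filter_range (l : List α) (a : α) :
    l.count a = ((Finset.range l.length).filter fun i => l[i]? = some a).card := by
  induction l with
  | nil => simp
  | cons b l ih =>
    rw [Finset.card_filter] at ih ⊢
    rw [List.length_cons, Finset.sum_range_succ', List.count_cons, ih]
    simp

/-- The valuation of a list divides the number of occurrences of each element. -/
theorem listVal_dvd_count (l : List α) (a : α) : listVal l ∣ l.count a := by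
  rcases eq_or_ne l [] with rfl | hl
  · simp
  -- Positions holding `a` become rotations with head `a`. This depends only on the rotated list, so
  -- they split into whole fibres of `l.rotate`, each of size `listVal l`.
  have h1 : ((Finset.range l.length).filter fun i => l[i]? = some a)
      = (Finset.range l.length).filter fun i => (l.rotate i).head? = some a := by
    refine Finset.filter_congr fun i hi => ?_
    rw [List.head?_rotate (Finset.mem_range.1 hi)]
  rw [count_eq_card_filter_range, h1, Finset.card_eq_sum_card_image l.rotate]
  refine Finset.dvd_sum fun l' hl' => ?_
  obtain ⟨j, hj, rfl⟩ := Finset.mem_image.1 hl'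
  rw [Finset.mem_filter] at hj
  rw [← card_filter_rotate_eq ⟨j, rfl⟩ hl, Finset.filter_filter]
  refine dvd_of_eq (congrArg _ (Finset.filter_congr fun i _ => ?_))
  constructor
  · intro h
    exact ⟨h ▸ hj.2, h⟩
  · exact fun h => h.2

end Rotations

/-! ### Divisibility of the product of factorials. -/

theorem CyclicWalk.val_dvd_visits {p : ℕ} (c : CyclicWalk p) (a : Fin p) :
    c.val ∣ c.visits a := by
  obtain ⟨c, hc⟩ := c
  induction c using Quotient.inductionOn' with
  | h l =>
    change listVal l ∣ Multiset.count a (l : Multiset (Fin p))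
    rw [Multiset.coe_count]
    exact listVal_dvd_count l a

theorem CyclicWalk.val_pos {p : ℕ} (c : CyclicWalk p) : 0 < c.val := by
  obtain ⟨c, hc⟩ := c
  induction c using Quotient.inductionOn' with
  | h l =>
    refine listVal_pos (l := l) ?_
    rintro rfl
    simpa using hc.1

theorem CyclicWalk.exists_visits_pos {p : ℕ} (c : CyclicWalk p) : ∃ a, 0 < c.visits a := by
  by_contra! h
  have h1 := sum_visits c
  have h2 := c.2.1
  rw [Finset.sum_eq_zero fun a _ => Nat.le_zero.1 (h a)] at h1
  omega

/-- In the inductive step, the top factor `(m + 1) * v` of the factorial absorbs `(m + 1) * d`, and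
the factors below it contain `(m * v)!` because `v` is positive. -/
theorem factorial_mul_pow_dvd_factorial_mul {d v : ℕ} (hdv : d ∣ v) (hv : 0 < v) (m : ℕ) :
    m ! * d ^ m ∣ (m * v)! := by
  induction m with
  | zero => simp
  | succ m ih =>
    obtain ⟨w, hw⟩ : ∃ w, (m + 1) * v = w + 1 := ⟨(m + 1) * v - 1, by
      have : 0 < (m + 1) * v := by positivity
      omega⟩
    rw [hw, Nat.factorial_succ w, ← hw, Nat.factorial_succ m, pow_succ,
      show (m + 1) * m ! * (d ^ m * d) = (m + 1) * d * (m ! * d ^ m) by ring]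
    refine mul_dvd_mul (mul_dvd_mul_left _ hdv) (ih.trans (Nat.factorial_dvd_factorial ?_))
    have : (m + 1) * v = m * v + v := by ring
    omega

theorem totalVisits_eq_sum_toFinset {p : ℕ} (C : Multiset (CyclicWalk p)) (a : Fin p) :
    totalVisits C a = ∑ c ∈ C.toFinset, C.count c * c.visits a := by
  rw [totalVisits, Finset.sum_multiset_map_count]
  simp only [smul_eq_mul]

/-- Each distinct walk is charged to one vertex that it visits, where its valuation divides its
number of visits. At each vertex, a product of factorials divides the factorial of the sum. -/
theorem multFactorial_mul_valProd_dvd {p : ℕ} {n : Fin p → ℕ} {C : Multiset (CyclicWalk p)}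
    (hC : C ∈ bounded n) : multFactorial C * valProd C ∣ ∏ a, (n a)! := by
  rw [mem_bounded] at hC
  calc multFactorial C * valProd C
      = ∏ c ∈ C.toFinset, (C.count c)! * c.val ^ C.count c := by
        rw [multFactorial, valProd, Finset.prod_multiset_map_count, Finset.prod_mul_distrib]
    _ ∣ ∏ c ∈ C.toFinset, ∏ a, (C.count c * c.visits a)! := by
        refine Finset.prod_dvd_prod_of_dvd _ _ fun c _ => ?_
        obtain ⟨a, ha⟩ := c.exists_visits_pos
        exact (factorial_mul_pow_dvd_factorial_mul (c.val_dvd_visits a) ha _).trans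
          (Finset.dvd_prod_of_mem _ (Finset.mem_univ a))
    _ = ∏ a, ∏ c ∈ C.toFinset, (C.count c * c.visits a)! := Finset.prod_comm
    _ ∣ ∏ a, (n a)! := by
        refine Finset.prod_dvd_prod_of_dvd _ _ fun a _ => ?_
        refine (Nat.prod_factorial_dvd_factorial_sum _ _).trans ?_
        rw [← totalVisits_eq_sum_toFinset]
        exact Nat.factorial_dvd_factorial (hC a)

/-! ### The exponential formula for multisets of walks. -/

section Weights

variable {p : ℕ}

theorem finite_multisets (p m : ℕ) :
    {C : Multiset (CyclicWalk p) | (C.map fun c => c.1.length).sum = m}.Finite := by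
  refine (finite_boundedSet fun _ : Fin p => m).subset fun C hC a => ?_
  rw [← show _ = m from hC, ← sum_totalVisits]
  exact Finset.single_le_sum (fun _ _ => Nat.zero_le _) (Finset.mem_univ a)

/-- The finite set of multisets of cyclic walks of total length `m`. -/
noncomputable def multisetsOfLength (p m : ℕ) : Finset (Multiset (CyclicWalk p)) :=
  (finite_multisets p m).toFinset

theorem mem_multisetsOfLength {m : ℕ} {C : Multiset (CyclicWalk p)} :
    C ∈ multisetsOfLength p m ↔ (C.map fun c => c.1.length).sum = m := by
  simp [multisetsOfLength]

theorem finite_walks (p k : ℕ) : {c : CyclicWalk p | c.1.length = k}.Finite := by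
  refine Set.Finite.of_finite_image ((finite_multisets p k).subset ?_)
    (f := fun c => ({c} : Multiset (CyclicWalk p)))
    (fun c _ d _ h => Multiset.singleton_inj.1 h)
  rintro _ ⟨c, hc, rfl⟩
  simpa using hc

/-- The finite set of cyclic walks of length `k`. -/
noncomputable def walksOfLength (p k : ℕ) : Finset (CyclicWalk p) :=
  (finite_walks p k).toFinset

theorem mem_walksOfLength {k : ℕ} {c : CyclicWalk p} :
    c ∈ walksOfLength p k ↔ c.1.length = k := by
  simp [walksOfLength]

theorem multisetsOfLength_zero : multisetsOfLength p 0 = {0} := by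
  ext C
  rw [mem_multisetsOfLength, Finset.mem_singleton]
  constructor
  · intro h
    refine Multiset.eq_zero_of_forall_notMem fun c hc => ?_
    have := Multiset.sum_eq_zero_iff.1 h _ (Multiset.mem_map_of_mem (fun c => c.1.length) hc)
    have := c.2.1
    omega
  · rintro rfl
    simp

theorem multFactorial_cons (c : CyclicWalk p) (C : Multiset (CyclicWalk p)) :
    multFactorial (c ::ₘ C) = (C.count c + 1) * multFactorial C := by
  have h : multFactorial C = ∏ d ∈ insert c C.toFinset, (C.count d)! := by
    refine Finset.prod_subset (Finset.subset_insert _ _) fun d _ hd => ?_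
    rw [Multiset.mem_toFinset] at hd
    rw [Multiset.count_eq_zero_of_notMem hd, Nat.factorial_zero]
  rw [h, multFactorial, Multiset.toFinset_cons]
  rw [← Finset.mul_prod_erase _ _ (Finset.mem_insert_self c _),
    ← Finset.mul_prod_erase (insert c C.toFinset) (fun d => (C.count d)!)
      (Finset.mem_insert_self c _), Multiset.count_cons_self, Nat.factorial_succ, ← mul_assoc]
  congr 1
  refine Finset.prod_congr rfl fun d hd => ?_
  rw [Multiset.count_cons_of_ne (Finset.ne_of_mem_erase hd)]

theorem multFactorial_pos (C : Multiset (CyclicWalk p)) : 0 < multFactorial C :=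
  Finset.prod_pos fun _ _ => Nat.factorial_pos _

variable {F L : Type*} [Field F] [CharZero F] [CommRing L] [Algebra F L]

/-- The contribution of a multiset of cyclic walks to the exponential of `∑ c, u c`. -/
noncomputable def expWeight (F : Type*) {L : Type*} [Field F] [CommRing L]
    [Algebra F L] (u : CyclicWalk p → L) (C : Multiset (CyclicWalk p)) : L :=
  (multFactorial C : F)⁻¹ • (C.map u).prod

/-- Marking one copy of `c` cancels one factor of `C!`: this is the rule `exp' = exp` at the level
of a single multiset. -/
theorem count_mul_expWeight (u : CyclicWalk p → L) (c : CyclicWalk p)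
    (C : Multiset (CyclicWalk p)) :
    ((c ::ₘ C).count c : L) * expWeight F u (c ::ₘ C) = u c * expWeight F u C := by
  unfold expWeight
  have h : ((C.count c + 1 : ℕ) : F) ≠ 0 := Nat.cast_ne_zero.2 (Nat.succ_ne_zero _)
  rw [Multiset.count_cons_self, multFactorial_cons, Multiset.map_cons, Multiset.prod_cons,
    ← map_natCast (algebraMap F L), ← Algebra.smul_def, smul_smul, Nat.cast_mul, mul_inv,
    ← mul_assoc, mul_inv_cancel₀ h, one_mul, mul_smul_comm]

/-- The exponential formula for multisets of cyclic walks, in the form of a recursion on the total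
length. -/
theorem sum_expWeight_succ (u : CyclicWalk p → L) (m : ℕ) :
    (m + 1 : L) * ∑ C ∈ multisetsOfLength p (m + 1), expWeight F u C
      = ∑ i ∈ Finset.range (m + 1), (∑ C ∈ multisetsOfLength p (m - i), expWeight F u C) *
          ∑ c ∈ walksOfLength p (i + 1), (i + 1 : L) * u c := by
  have h1 : ∀ C ∈ multisetsOfLength p (m + 1), (m + 1 : L) * expWeight F u C
      = ∑ c ∈ C.toFinset, (c.1.length : L) * (u c * expWeight F u (C.erase c)) := by
    intro C hC
    rw [mem_multisetsOfLength, Finset.sum_multiset_map_count] at hC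
    -- The factor `m + 1` is the total length of `C`, and is distributed over its walks with their
    -- multiplicities.
    have : (m + 1 : L) = ∑ c ∈ C.toFinset, (C.count c : L) * c.1.length := by
      have := congrArg (Nat.cast : ℕ → L) hC
      push_cast [smul_eq_mul] at this
      exact this.symm
    rw [this, Finset.sum_mul]
    refine Finset.sum_congr rfl fun c hc => ?_
    have h2 := count_mul_expWeight (F := F) u c (C.erase c)
    rw [Multiset.cons_erase (Multiset.mem_toFinset.1 hc)] at h2
    rw [← h2]
    ring
  rw [Finset.mul_sum, Finset.sum_congr rfl h1, Finset.sum_sigma']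
  simp only [Finset.sum_mul_sum]
  simp only [← Finset.sum_product']
  rw [Finset.sum_sigma']
  have hpos : ∀ c : CyclicWalk p, c.1.length - 1 + 1 = c.1.length := fun c => by
    have := c.2.1
    omega
  have hlen : ∀ C : Multiset (CyclicWalk p), ∀ c ∈ C,
      c.1.length + ((C.erase c).map fun c => c.1.length).sum
        = (C.map fun c => c.1.length).sum := by
    intro C c hc
    conv_rhs => rw [← Multiset.cons_erase hc]
    simp
  -- A multiset with a marked walk corresponds to the marked walk and the remaining multiset; `i` is
  -- the length of the marked walk minus one.
  refine Finset.sum_bij' (fun x _ => ⟨x.2.1.length - 1, (x.1.erase x.2, x.2)⟩)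
    (fun x _ => ⟨x.2.2 ::ₘ x.2.1, x.2.2⟩) ?_ ?_ ?_ ?_ ?_
  · rintro ⟨C, c⟩ h
    simp only [Finset.mem_sigma, mem_multisetsOfLength, Multiset.mem_toFinset] at h
    simp only [Finset.mem_sigma, Finset.mem_product, mem_multisetsOfLength, mem_walksOfLength,
      Finset.mem_range]
    have h3 := hlen C c h.2
    have h4 := hpos c
    have h5 := h.1
    refine ⟨?_, ?_, ?_⟩ <;> omega
  · rintro ⟨i, C, c⟩ h
    simp only [Finset.mem_sigma, Finset.mem_product, mem_multisetsOfLength, mem_walksOfLength,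
      Finset.mem_range] at h
    simp only [Finset.mem_sigma, mem_multisetsOfLength, Multiset.mem_toFinset,
      Multiset.map_cons, Multiset.sum_cons, Multiset.mem_cons_self, and_true]
    omega
  · rintro ⟨C, c⟩ h
    simp only [Finset.mem_sigma, Multiset.mem_toFinset] at h
    simp only [Multiset.cons_erase h.2]
  · rintro ⟨i, C, c⟩ h
    simp only [Finset.mem_sigma, Finset.mem_product, mem_walksOfLength] at h
    simp only [Multiset.erase_cons_head, h.2.2, Nat.add_sub_cancel]
  · rintro ⟨C, c⟩ h
    have := congrArg (Nat.cast : ℕ → L) (hpos c)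
    push_cast at this
    simp only [this]
    ring

end Weights

/-! ### Traces of powers as sums over cyclic walks. -/

section Traces

variable {R : Type*} [CommRing R] {p : ℕ} {n : Fin p → ℕ}

theorem block_mul (A B : Matrix (Idx n) (Idx n) R) (a b : Fin p) :
    block (A * B) a b = ∑ c, block A a c * block B c b := by
  ext i j
  simp only [block, Matrix.of_apply, Matrix.mul_apply, Matrix.sum_apply, Fintype.sum_sigma]

theorem block_pow_succ (A : Matrix (Idx n) (Idx n) R) (k : ℕ) (a b : Fin p) :
    block (A ^ (k + 1)) a b = ∑ f : Fin k → Fin p, pathProd A a (List.ofFn f) b := by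
  induction k generalizing a with
  | zero => simp [pathProd]
  | succ k ih =>
    rw [pow_succ', block_mul, ← (Fin.consEquiv fun _ => Fin p).sum_comp, Fintype.sum_prod_type]
    refine Finset.sum_congr rfl fun c _ => ?_
    rw [ih, Matrix.mul_sum]
    refine Finset.sum_congr rfl fun f _ => ?_
    simp [Fin.consEquiv, pathProd]

theorem trace_pow_succ (A : Matrix (Idx n) (Idx n) R) (k : ℕ) :
    (A ^ (k + 1)).trace = ∑ f : Fin (k + 1) → Fin p, listTrace A (List.ofFn f) := by
  have h : (A ^ (k + 1)).trace = ∑ a, (block (A ^ (k + 1)) a a).trace := by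
    simp only [Matrix.trace, Fintype.sum_sigma]
    rfl
  rw [h, ← (Fin.consEquiv fun _ => Fin p).sum_comp, Fintype.sum_prod_type]
  refine Finset.sum_congr rfl fun a _ => ?_
  rw [block_pow_succ, Matrix.trace_sum]
  refine Finset.sum_congr rfl fun f _ => ?_
  simp [Fin.consEquiv, listTrace]

/-- A repeated consecutive vertex inserts a diagonal block, which vanishes. This is why only cyclic
walks contribute to the traces. -/
theorem pathProd_eq_zero {A : Matrix (Idx n) (Idx n) R} (hA : ∀ a, block A a a = 0) (a b : Fin p)
    (l : List (Fin p)) (h : ¬ (a :: (l ++ [b])).IsChain (· ≠ ·)) : pathProd A a l b = 0 := by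
  induction l generalizing a with
  | nil =>
    have : a = b := by simpa using h
    subst this
    exact hA a
  | cons c l ih =>
    rw [pathProd]
    by_cases hac : a = c
    · subst hac
      rw [hA, Matrix.zero_mul]
    · rw [ih, Matrix.mul_zero]
      intro h2
      exact h (List.isChain_cons_cons.2 ⟨hac, h2⟩)

theorem two_le_length_of_chain {l : List (Fin p)} (hl : l ≠ [])
    (h : (l : Cycle (Fin p)).Chain (· ≠ ·)) : 2 ≤ (l : Cycle (Fin p)).length := by
  match l, hl with
  | [a], _ => simp at h
  | a :: b :: l, _ => simp

theorem listTrace_eq_zero {A : Matrix (Idx n) (Idx n) R} (hA : ∀ a, block A a a = 0)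
    (l : List (Fin p)) (h : ¬ (l : Cycle (Fin p)).Chain (· ≠ ·)) : listTrace A l = 0 := by
  cases l with
  | nil => rfl
  | cons a l =>
    rw [listTrace, pathProd_eq_zero hA, Matrix.trace_zero]
    rwa [Cycle.chain_coe_cons] at h

/-- The number of lists which represent a cyclic walk. -/
theorem card_ofFn_eq_mul_val {k : ℕ} (c : CyclicWalk p) (hc : c.1.length = k) :
    (Finset.univ.filter fun f : Fin k → Fin p => (List.ofFn f : Cycle (Fin p)) = c.1).card * c.val
      = k := by
  obtain ⟨c, hc'⟩ := c
  induction c using Quotient.inductionOn' with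
  | h l =>
    subst hc
    have hl : l ≠ [] := by
      rintro rfl
      simpa using hc'.1
    refine Eq.trans ?_ (card_rotations_mul_listVal hl)
    congr 1
    refine Finset.card_bij (fun f _ => List.ofFn f) ?_ ?_ ?_
    · intro f hf
      rw [mem_image_rotate_iff hl]
      exact (Finset.mem_filter.1 hf).2
    · intro f _ g _ h
      exact List.ofFn_injective h
    · intro l' hl'
      have hlen : l'.length = l.length := by
        obtain ⟨i, -, rfl⟩ := Finset.mem_image.1 hl'
        exact List.length_rotate _ _
      rw [mem_image_rotate_iff hl] at hl'
      have : List.ofFn (fun i : Fin l.length => l'.get (i.cast hlen.symm)) = l' := by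
        refine List.ext_getElem (by simp [hlen]) fun i _ _ => by simp
      refine ⟨fun i => l'.get (i.cast hlen.symm), ?_, this⟩
      rw [Finset.mem_filter]
      refine ⟨Finset.mem_univ _, ?_⟩
      exact (congrArg _ this).trans hl'

/-- The lists are grouped by the cycle they represent, on which the trace is constant; those that
represent no cyclic walk contribute zero. -/
theorem sum_listTrace_eq {A : Matrix (Idx n) (Idx n) R} (hA : ∀ a, block A a a = 0) (k : ℕ) :
    ∑ f : Fin (k + 1) → Fin p, listTrace A (List.ofFn f)
      = ∑ c ∈ walksOfLength p (k + 1), ((Finset.univ.filter fun f : Fin (k + 1) → Fin p =>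
          (List.ofFn f : Cycle (Fin p)) = c.1).card : R) * W A c := by
  have h1 : ∀ f : Fin (k + 1) → Fin p, listTrace A (List.ofFn f)
      = ∑ c ∈ walksOfLength p (k + 1),
          if (List.ofFn f : Cycle (Fin p)) = c.1 then W A c else 0 := by
    intro f
    by_cases hf : (List.ofFn f : Cycle (Fin p)).Chain (· ≠ ·)
    · have h2 := two_le_length_of_chain (l := List.ofFn f) (by simp) hf
      rw [Finset.sum_eq_single (⟨List.ofFn f, h2, hf⟩ : CyclicWalk p)]
      · rw [if_pos rfl, W_mk]
      · intro c _ hc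
        rw [if_neg]
        rintro h
        exact hc (Subtype.ext h.symm)
      · intro h
        refine absurd ?_ h
        rw [mem_walksOfLength]
        simp
    · rw [listTrace_eq_zero hA _ hf, Finset.sum_eq_zero]
      intro c _
      rw [if_neg]
      rintro h
      exact hf (h ▸ c.2.2)
  simp only [h1]
  rw [Finset.sum_comm]
  refine Finset.sum_congr rfl fun c _ => ?_
  rw [Finset.sum_ite, Finset.sum_const, Finset.sum_const_zero, add_zero, nsmul_eq_mul]

end Traces

/-! ### The expansion with variables in place of the inverse diagonal scalars. -/

section Generic

variable {p : ℕ} {n : Fin p → ℕ}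

/-- The exponent vector which records the visits of a cyclic walk. -/
noncomputable def visitsVec (c : CyclicWalk p) : Fin p →₀ ℕ :=
  Multiset.toFinsupp c.1.toMultiset

theorem visitsVec_apply (c : CyclicWalk p) (a : Fin p) : visitsVec c a = c.visits a :=
  Multiset.toFinsupp_apply _ _

/-- The exponent vector which records the visits of a multiset of cyclic walks. -/
noncomputable def totalVisitsVec (C : Multiset (CyclicWalk p)) : Fin p →₀ ℕ :=
  (C.map visitsVec).sum

theorem totalVisitsVec_apply (C : Multiset (CyclicWalk p)) (a : Fin p) :
    totalVisitsVec C a = totalVisits C a := by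
  unfold totalVisitsVec totalVisits
  induction C using Multiset.induction_on with
  | empty => simp
  | cons c C ih => simp [ih, visitsVec_apply]

/-- The matrix `-Y N`, where `N` is the off-diagonal part of `A` and `Y` multiplies the rows of the
block of index `a` by the variable of index `a`. -/
noncomputable def negScaled {F : Type*} [CommRing F] (A : Matrix (Idx n) (Idx n) F) :
    Matrix (Idx n) (Idx n) (MvPolynomial (Fin p) F) :=
  Matrix.of fun x y => if x.1 = y.1 then 0 else MvPolynomial.X x.1 * MvPolynomial.C (-A x y)

theorem block_negScaled_self {F : Type*} [CommRing F] (A : Matrix (Idx n) (Idx n) F) (a : Fin p) :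
    block (negScaled A) a a = 0 := by
  ext i j
  simp [block, negScaled]

theorem block_negScaled_ne {F : Type*} [CommRing F] (A : Matrix (Idx n) (Idx n) F) {a b : Fin p}
    (h : a ≠ b) : block (negScaled A) a b
      = (MvPolynomial.X a : MvPolynomial (Fin p) F) • (block (-A) a b).map MvPolynomial.C := by
  ext1 i j
  simp [block, negScaled, h]

/-- Each step carries the variable of its starting vertex, so the endpoint `b` contributes none, and
a closed path records each visit once. -/
theorem pathProd_negScaled {F : Type*} [CommRing F] (A : Matrix (Idx n) (Idx n) F) (a b : Fin p)
    (l : List (Fin p)) (h : (a :: (l ++ [b])).IsChain (· ≠ ·)) :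
    pathProd (negScaled A) a l b
      = ((a :: l).map (MvPolynomial.X (R := F))).prod • (pathProd (-A) a l b).map MvPolynomial.C := by
  induction l generalizing a with
  | nil =>
    have : a ≠ b := by simpa using h
    simp [pathProd, block_negScaled_ne A this]
  | cons c l ih =>
    obtain ⟨h1, h2⟩ := List.isChain_cons_cons.1 h
    rw [pathProd, pathProd, ih c h2, block_negScaled_ne A h1, Matrix.map_mul,
      Matrix.smul_mul, Matrix.mul_smul, smul_smul, List.map_cons (l := c :: l), List.prod_cons]

theorem prod_map_X {F : Type*} [CommRing F] (l : List (Fin p)) :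
    (l.map (MvPolynomial.X (R := F))).prod
      = MvPolynomial.monomial (Multiset.toFinsupp (l : Multiset (Fin p))) 1 := by
  induction l with
  | nil => simp
  | cons a l ih =>
    rw [List.map_cons, List.prod_cons, ih, MvPolynomial.X, MvPolynomial.monomial_mul, one_mul,
      ← Multiset.cons_coe, ← Multiset.singleton_add, map_add, Multiset.toFinsupp_singleton]

theorem W_negScaled {F : Type*} [CommRing F] (A : Matrix (Idx n) (Idx n) F) (c : CyclicWalk p) :
    W (negScaled A) c = MvPolynomial.monomial (visitsVec c) (W (-A) c) := by
  obtain ⟨c, hc⟩ := c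
  induction c using Quotient.inductionOn' with
  | h l =>
    change listTrace (negScaled A) l
      = MvPolynomial.monomial (Multiset.toFinsupp (l : Multiset (Fin p))) (listTrace (-A) l)
    cases l with
    | nil => simp [listTrace]
    | cons a l =>
      have h := hc.2
      change ((a :: l : List (Fin p)) : Cycle (Fin p)).Chain _ at h
      rw [Cycle.chain_coe_cons] at h
      have h2 : ((pathProd (-A) a l a).map (MvPolynomial.C (σ := Fin p))).trace
          = MvPolynomial.C (pathProd (-A) a l a).trace := by
        simp [Matrix.trace]
      rw [listTrace, listTrace, pathProd_negScaled A _ _ _ h, Matrix.trace_smul, h2, prod_map_X,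
        smul_eq_mul, mul_comm, MvPolynomial.C_mul_monomial, mul_one]

variable {F : Type*} [Field F]

/-- The monomial attached to a cyclic walk. -/
noncomputable def walkMonomial (A : Matrix (Idx n) (Idx n) F) (c : CyclicWalk p) :
    MvPolynomial (Fin p) F :=
  MvPolynomial.monomial (visitsVec c) (-W (-A) c / (c.val : F))

theorem expWeight_walkMonomial (A : Matrix (Idx n) (Idx n) F) (C : Multiset (CyclicWalk p)) :
    expWeight F (walkMonomial A) C = MvPolynomial.monomial (totalVisitsVec C)
      ((multFactorial C : F)⁻¹ * (C.map fun c => -W (-A) c / (c.val : F)).prod) := by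
  rw [expWeight, ← smul_eq_mul, ← MvPolynomial.smul_monomial]
  congr 1
  unfold totalVisitsVec
  induction C using Multiset.induction_on with
  | empty => simp
  | cons c C ih =>
    rw [Multiset.map_cons, Multiset.prod_cons, ih, walkMonomial, MvPolynomial.monomial_mul]
    simp

/-- The determinant of `1 + Y N` has degree at most `n a` in the variable of index `a`. -/
theorem degreeOf_det_one_sub_negScaled (A : Matrix (Idx n) (Idx n) F) (a : Fin p) :
    (1 - negScaled A).det.degreeOf a ≤ n a := by
  have hentry : ∀ x y : Idx n,
      ((1 - negScaled A) x y).degreeOf a ≤ if x.1 = a then 1 else 0 := by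
    intro x y
    have h0 : ((1 : Matrix (Idx n) (Idx n) (MvPolynomial (Fin p) F)) x y).degreeOf a = 0 := by
      rw [Matrix.one_apply]
      split_ifs
      · exact MvPolynomial.degreeOf_one a
      · exact MvPolynomial.degreeOf_zero a
    rw [Matrix.sub_apply]
    by_cases hxy : x.1 = y.1
    · simp [negScaled, hxy, h0]
    · refine (MvPolynomial.degreeOf_sub_le _ _ _).trans ?_
      rw [h0, max_eq_right (Nat.zero_le _)]
      simp only [negScaled, Matrix.of_apply, if_neg hxy]
      refine (MvPolynomial.degreeOf_mul_le _ _ _).trans ?_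
      rw [MvPolynomial.degreeOf_C, add_zero, MvPolynomial.degreeOf_X]
      simp only [eq_comm, le_refl]
  -- The transpose makes each term a product over rows; only the `n a` rows of block `a` involve the
  -- variable of index `a`, each with degree at most one.
  rw [← Matrix.det_transpose, Matrix.det_apply]
  refine (MvPolynomial.degreeOf_sum_le _ _ _).trans (Finset.sup_le fun σ _ => ?_)
  have h1 : (∏ x, (1 - negScaled A).transpose (σ x) x).degreeOf a ≤ n a := by
    refine (MvPolynomial.degreeOf_prod_le _ _ _).trans ?_
    refine (Finset.sum_le_sum fun x _ => hentry x (σ x)).trans ?_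
    rw [Fintype.sum_sigma, Finset.sum_eq_single a (fun b _ hb => by simp [hb]) (by simp)]
    simp
  rcases Int.units_eq_one_or (Equiv.Perm.sign σ) with h | h
  · rwa [h, one_smul]
  · rwa [h, Units.neg_smul, one_smul, MvPolynomial.degreeOf_neg]

variable [CharZero F]

theorem neg_trace_pow_negScaled (A : Matrix (Idx n) (Idx n) F) (k : ℕ) :
    -(negScaled A ^ (k + 1)).trace
      = ∑ c ∈ walksOfLength p (k + 1), (k + 1 : MvPolynomial (Fin p) F) * walkMonomial A c := by
  rw [trace_pow_succ, sum_listTrace_eq (block_negScaled_self A), ← Finset.sum_neg_distrib]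
  refine Finset.sum_congr rfl fun c hc => ?_
  have h := card_ofFn_eq_mul_val c (mem_walksOfLength.1 hc)
  set N := (Finset.univ.filter fun f : Fin (k + 1) → Fin p =>
    (List.ofFn f : Cycle (Fin p)) = c.1).card
  have h1 : (k + 1 : F) = N * c.val := by exact_mod_cast h.symm
  have h2 : (c.val : F) ≠ 0 := Nat.cast_ne_zero.2 c.val_pos.ne'
  have h3 : (k + 1 : MvPolynomial (Fin p) F) = MvPolynomial.C (k + 1 : F) := by simp
  have h4 : (N : MvPolynomial (Fin p) F) = MvPolynomial.C (N : F) := by simp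
  rw [W_negScaled, walkMonomial, h3, h4, MvPolynomial.C_mul_monomial,
    MvPolynomial.C_mul_monomial, ← map_neg, h1]
  congr 1
  field_simp

/-- Both sides obey the same recursion, and `m + 1` can be cancelled in characteristic zero. -/
theorem coeff_charpolyRev_negScaled (A : Matrix (Idx n) (Idx n) F) (m : ℕ) :
    (negScaled A).charpolyRev.coeff m
      = ∑ C ∈ multisetsOfLength p m, expWeight F (walkMonomial A) C := by
  induction m using Nat.strong_induction_on with
  | _ m ih =>
    cases m with
    | zero =>
      rw [Polynomial.coeff_zero_eq_eval_zero, Matrix.eval_charpolyRev, multisetsOfLength_zero]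
      simp [expWeight, multFactorial]
    | succ m =>
      have h : (m + 1 : MvPolynomial (Fin p) F) ≠ 0 := by exact_mod_cast Nat.succ_ne_zero m
      apply mul_left_cancel₀ h
      rw [newton_charpolyRev, sum_expWeight_succ]
      refine Finset.sum_congr rfl fun i _ => ?_
      rw [ih (m - i) (by omega), neg_trace_pow_negScaled]

theorem det_one_sub_negScaled (A : Matrix (Idx n) (Idx n) F) :
    (1 - negScaled A).det = ∑ C ∈ bounded n, expWeight F (walkMonomial A) C := by
  classical
  have h1 : (1 - negScaled A).det = (negScaled A).charpolyRev.eval 1 := by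
    rw [Matrix.charpolyRev, ← Polynomial.coe_evalRingHom, RingHom.map_det]
    congr 1
    ext1 x y
    by_cases hxy : x = y <;> simp [hxy]
  -- Large enough to exceed both the degree of the polynomial and the total length of every bounded
  -- multiset.
  set D := max (negScaled A).charpolyRev.natDegree (∑ a, n a) + 1
  have h2 : (1 - negScaled A).det
      = ∑ C ∈ (Finset.range D).biUnion (multisetsOfLength p), expWeight F (walkMonomial A) C := by
    rw [h1, Polynomial.eval_eq_sum_range' (Nat.lt_succ_of_le (le_max_left _ (∑ a, n a))),
      Finset.sum_biUnion]
    · simp [coeff_charpolyRev_negScaled, D]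
    · intro i _ j _ hij
      rw [Function.onFun, Finset.disjoint_left]
      intro C hi hj
      rw [mem_multisetsOfLength] at hi hj
      exact hij (hi.symm.trans hj)
  have hsub : bounded n ⊆ (Finset.range D).biUnion (multisetsOfLength p) := by
    intro C hC
    rw [mem_bounded] at hC
    rw [Finset.mem_biUnion]
    refine ⟨_, ?_, mem_multisetsOfLength.2 rfl⟩
    rw [Finset.mem_range, ← sum_totalVisits]
    exact Nat.lt_succ_of_le ((Finset.sum_le_sum fun a _ => hC a).trans (le_max_right _ _))
  rw [← Finset.sum_sdiff hsub] at h2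
  rw [h2, add_eq_right]
  -- The unbounded multisets cancel in total. At an exponent within the bounds none of them
  -- contributes; at any other, neither the determinant nor the bounded sum has a coefficient, so
  -- the remainder has none.
  ext v
  rw [MvPolynomial.coeff_zero]
  by_cases hv : ∀ a, v a ≤ n a
  · rw [MvPolynomial.coeff_sum]
    refine Finset.sum_eq_zero fun C hC => ?_
    rw [Finset.mem_sdiff, mem_bounded] at hC
    rw [expWeight_walkMonomial, MvPolynomial.coeff_monomial, if_neg]
    rintro rfl
    exact hC.2 fun a => totalVisitsVec_apply C a ▸ hv a
  · push Not at hv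
    obtain ⟨a, ha⟩ := hv
    have h3 : (1 - negScaled A).det.coeff v = 0 := by
      by_contra h
      exact absurd (MvPolynomial.degreeOf_le_iff.1 (degreeOf_det_one_sub_negScaled A a) v
        (MvPolynomial.mem_support_iff.2 h)) (not_le.2 ha)
    have h4 : (∑ C ∈ bounded n, expWeight F (walkMonomial A) C).coeff v = 0 := by
      rw [MvPolynomial.coeff_sum]
      refine Finset.sum_eq_zero fun C hC => ?_
      rw [mem_bounded] at hC
      rw [expWeight_walkMonomial, MvPolynomial.coeff_monomial, if_neg]
      rintro rfl
      rw [totalVisitsVec_apply] at ha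
      exact absurd (hC a) (not_le.2 ha)
    rw [h2, MvPolynomial.coeff_add, h4, add_zero] at h3
    exact h3

/-- The expansion of the determinant when the diagonal scalars are invertible. -/
theorem det_eq_sum_bounded_of_ne_zero (A : Matrix (Idx n) (Idx n) F) (z : Fin p → F)
    (hz : ∀ a, z a ≠ 0) (hA : ∀ a, block A a a = z a • (1 : Matrix (Fin (n a)) (Fin (n a)) F)) :
    A.det = ∑ C ∈ bounded n, (∏ a, z a ^ (n a - totalVisits C a)) / (multFactorial C : F) *
      (C.map fun c => -W (-A) c / (c.val : F)).prod := by
  have h1 : A = Matrix.diagonal (fun x : Idx n => z x.1) *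
      (MvPolynomial.eval fun a => (z a)⁻¹).mapMatrix (1 - negScaled A) := by
    ext ⟨a, i⟩ ⟨b, j⟩
    rw [Matrix.diagonal_mul]
    by_cases hab : a = b
    · subst hab
      have := congrFun (congrFun (hA a) i) j
      simp only [block, Matrix.of_apply, Matrix.smul_apply, smul_eq_mul] at this
      rw [this]
      by_cases hij : i = j <;> simp [negScaled, hij, Matrix.one_apply]
    · have : (⟨a, i⟩ : Idx n) ≠ ⟨b, j⟩ := fun h => hab (congrArg Sigma.fst h)
      simp [negScaled, hab, this, hz]
  have h2 := congrArg Matrix.det h1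
  rw [Matrix.det_mul, Matrix.det_diagonal, ← RingHom.map_det, det_one_sub_negScaled, map_sum,
    Fintype.prod_sigma, Finset.mul_sum] at h2
  rw [h2]
  refine Finset.sum_congr rfl fun C hC => ?_
  rw [mem_bounded] at hC
  rw [expWeight_walkMonomial, MvPolynomial.eval_monomial, Finsupp.prod_fintype _ _ (by simp)]
  simp only [totalVisitsVec_apply, Finset.prod_const, Finset.card_univ, Fintype.card_fin]
  have h3 : ∏ a, z a ^ (n a - totalVisits C a)
      = (∏ a, z a ^ n a) * ∏ a, (z a)⁻¹ ^ totalVisits C a := by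
    rw [← Finset.prod_mul_distrib]
    refine Finset.prod_congr rfl fun a _ => ?_
    rw [pow_sub₀ _ (hz a) (hC a), inv_pow]
  rw [h3]
  ring

end Generic

/-! ### From the generic matrix to arbitrary commutative rings. -/

section Transfer

variable {p : ℕ} {n : Fin p → ℕ}

theorem pathProd_map {R S : Type*} [CommRing R] [CommRing S] (f : R →+* S)
    (A : Matrix (Idx n) (Idx n) R) (a b : Fin p) (l : List (Fin p)) :
    pathProd (A.map f) a l b = (pathProd A a l b).map f := by
  induction l generalizing a with
  | nil => rfl
  | cons c l ih => rw [pathProd, pathProd, ih, Matrix.map_mul]; rfl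

theorem W_map {R S : Type*} [CommRing R] [CommRing S] (f : R →+* S)
    (A : Matrix (Idx n) (Idx n) R) (c : CyclicWalk p) : W (A.map f) c = f (W A c) := by
  obtain ⟨c, hc⟩ := c
  induction c using Quotient.inductionOn' with
  | h l =>
    change listTrace (A.map f) l = f (listTrace A l)
    cases l with
    | nil => exact (map_zero f).symm
    | cons a l => simp [listTrace, pathProd_map, Matrix.trace]

/-- The right-hand side of the integral determinant formula. -/
noncomputable def walkSum {R : Type*} [CommRing R] (A : Matrix (Idx n) (Idx n) R)
    (z : Fin p → R) : R :=
  ∑ C ∈ bounded n, (((∏ a, (n a)!) / (multFactorial C * valProd C) : ℕ) : R) *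
    (∏ a, z a ^ (n a - totalVisits C a)) * (C.map fun c => -W (-A) c).prod

theorem walkSum_map {R S : Type*} [CommRing R] [CommRing S] (f : R →+* S)
    (A : Matrix (Idx n) (Idx n) R) (z : Fin p → R) :
    walkSum (A.map f) (fun a => f (z a)) = f (walkSum A z) := by
  have h : -A.map f = (-A).map f := by
    ext
    simp
  simp only [walkSum, map_sum, map_mul, map_natCast, map_prod, map_pow, map_multiset_prod,
    Multiset.map_map, Function.comp_def, map_neg, h, W_map]

theorem valProd_pos (C : Multiset (CyclicWalk p)) : 0 < valProd C := by
  rw [valProd, Finset.prod_multiset_map_count]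
  exact Finset.prod_pos fun c _ => pow_pos c.val_pos _

theorem walkSum_eq_mul {K : Type*} [Field K] [CharZero K] (A : Matrix (Idx n) (Idx n) K)
    (z : Fin p → K) :
    walkSum A z = ((∏ a, (n a)! : ℕ) : K) *
      ∑ C ∈ bounded n, (∏ a, z a ^ (n a - totalVisits C a)) / (multFactorial C : K) *
        (C.map fun c => -W (-A) c / (c.val : K)).prod := by
  rw [walkSum, Finset.mul_sum]
  refine Finset.sum_congr rfl fun C hC => ?_
  have h1 : (multFactorial C : K) ≠ 0 := Nat.cast_ne_zero.2 (multFactorial_pos C).ne'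
  have h2 : (valProd C : K) ≠ 0 := Nat.cast_ne_zero.2 (valProd_pos C).ne'
  have h3 : (C.map fun c => -W (-A) c / (c.val : K)).prod
      = (C.map fun c => -W (-A) c).prod / valProd C := by
    rw [Multiset.prod_map_div, valProd, Nat.cast_multiset_prod, Multiset.map_map]
    rfl
  rw [Nat.cast_div (multFactorial_mul_valProd_dvd hC) (by
    rw [Nat.cast_mul]
    exact mul_ne_zero h1 h2), h3, Nat.cast_mul]
  field_simp

/-- The variables of the generic block matrix: its off-diagonal entries and its diagonal scalars. -/
abbrev GenericRing (n : Fin p → ℕ) : Type := MvPolynomial ((Idx n × Idx n) ⊕ Fin p) ℤ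

/-- The generic block matrix with scalar diagonal blocks. -/
noncomputable def genericMatrix (n : Fin p → ℕ) : Matrix (Idx n) (Idx n) (GenericRing n) :=
  Matrix.of fun x y => if x.1 = y.1 then (if x = y then MvPolynomial.X (Sum.inr x.1) else 0)
    else MvPolynomial.X (Sum.inl (x, y))

/-- The generic ring is a domain of characteristic zero, so it embeds in its fraction field, where
the diagonal variables are nonzero and the field expansion applies. -/
theorem genericMatrix_det (n : Fin p → ℕ) :
    ((∏ a, (n a)! : ℕ) : GenericRing n) * (genericMatrix n).det
      = walkSum (genericMatrix n) fun a => MvPolynomial.X (Sum.inr a) := by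
  set f := algebraMap (GenericRing n) (FractionRing (GenericRing n)) with hf
  have hinj : Function.Injective f := IsFractionRing.injective _ _
  have : CharZero (FractionRing (GenericRing n)) := charZero_of_injective_algebraMap hinj
  apply hinj
  rw [← walkSum_map, walkSum_eq_mul, ← det_eq_sum_bounded_of_ne_zero, map_mul, map_natCast,
    RingHom.map_det]
  · rfl
  · intro a h
    exact MvPolynomial.X_ne_zero _ (hinj (h.trans (map_zero f).symm))
  · intro a
    ext i j
    by_cases hij : i = j <;> simp [block, genericMatrix, hij]

theorem factorial_mul_det_eq_walkSum {R : Type*} [CommRing R] (A : Matrix (Idx n) (Idx n) R)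
    (z : Fin p → R) (hA : ∀ a, block A a a = z a • (1 : Matrix (Fin (n a)) (Fin (n a)) R)) :
    ((∏ a, (n a)! : ℕ) : R) * A.det = walkSum A z := by
  let f : GenericRing n →+* R :=
    MvPolynomial.eval₂Hom (Int.castRingHom R) (Sum.elim (fun x => A x.1 x.2) z)
  have h1 : (genericMatrix n).map f = A := by
    ext ⟨a, i⟩ ⟨b, j⟩
    by_cases hab : a = b
    · subst hab
      have := congrFun (congrFun (hA a) i) j
      simp only [block, Matrix.of_apply, Matrix.smul_apply, smul_eq_mul] at this
      rw [this]
      by_cases hij : i = j <;> simp [genericMatrix, hij, f, Matrix.one_apply]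
    · simp [genericMatrix, hab, f]
  have h2 : (fun a => f (MvPolynomial.X (Sum.inr a))) = z := by
    ext a
    simp [f]
  have h3 := congrArg f (genericMatrix_det n)
  rw [map_mul, map_natCast, RingHom.map_det, ← walkSum_map, h2] at h3
  change _ * ((genericMatrix n).map f).det = _ at h3
  rwa [h1] at h3

end Transfer

end BlockWalk

theorem theorem3p1 {K : Type*} [Field K] [CharZero K] {R : Type*} [CommRing R]
    (p : ℕ) (n : Fin p → ℕ) :
    -- the formula over a field of characteristic zero
    (∀ (A : Matrix (Idx n) (Idx n) K) (z : Fin p → K),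
      (∀ a, block A a a = z a • (1 : Matrix (Fin (n a)) (Fin (n a)) K)) →
      A.det = ∑ C ∈ bounded n,
        (∏ a, z a ^ (n a - totalVisits C a)) / (multFactorial C : K) *
          (C.map fun c => -W (-A) c / (c.val : K)).prod) ∧
    -- the coefficients of the integral formula are integers
    (∀ C ∈ bounded n, multFactorial C * valProd C ∣ ∏ a, (n a)!) ∧
    -- the integral formula over a commutative ring
    (∀ (A : Matrix (Idx n) (Idx n) R) (z : Fin p → R),
      (∀ a, block A a a = z a • (1 : Matrix (Fin (n a)) (Fin (n a)) R)) →
      ((∏ a, (n a)! : ℕ) : R) * A.det = ∑ C ∈ bounded n,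
        (((∏ a, (n a)!) / (multFactorial C * valProd C) : ℕ) : R) *
          (∏ a, z a ^ (n a - totalVisits C a)) * (C.map fun c => -W (-A) c).prod) := by
  refine ⟨fun A z hA => ?_, fun C hC => multFactorial_mul_valProd_dvd hC,
    fun A z hA => factorial_mul_det_eq_walkSum A z hA⟩
  -- Passing through the integral formula removes the restriction to nonzero `z a`; characteristic
  -- zero then permits cancelling the factorials.
  have h := factorial_mul_det_eq_walkSum A z hA
  rw [walkSum_eq_mul] at h
  refine mul_left_cancel₀ (Nat.cast_ne_zero.2 ?_) h
  exact Finset.prod_ne_zero_iff.2 fun a _ => Nat.factorial_ne_zero _
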